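/- Let $\mathfrak g$ be a complex Lie algebra and $\kappa\in \mathrm{Sym}^2(\mathfrak g^*)^{\mathfrak g}$ an invariant symmetric bilinear form. Write $(z_1,z_2)$ for the coordinates of $\mathbb C^2$, $\pi:\mathbb C^2\to\mathbb C_{z_1}$ for the projection to the first coordinate, and let $\varepsilon$ be a parameter of degree $-1$. A Chevalley–Eilenberg cochain of a dg Lie algebra $L$ is regarded as a function on $L[1]$, that is, it is evaluated on elements of $L$ of odd total parity with coefficients in Grassmann algebras of auxiliary parameters (its multilinear components being the coefficients of the monomials in the parameters). Consider * the degree one cocycle $\displaystyle \phi^{2d}_\kappa(\alpha)=\frac1{2\pi i}\int_{\mathbb C}\kappa(\alpha\wedge\partial\alpha)$ on $\Omega^{0,\bullet}_c(\mathbb C_{z_1},\mathfrak g)$; * the degree one cocycle $\displaystyle \phi^{4d}_\kappa(\alpha+\varepsilon\alpha')=\frac1{(2\pi i)^2}\int_{\mathbb C^2}\kappa(\alpha\wedge\partial\alpha')\wedge dz_2$ on $\bigl(\Omega^{0,\bullet}_c(\mathbb C^2,\mathfrak g[\varepsilon]),\ \bar\partial+z_2\tfrac{\partial}{\partial\varepsilon}\bigr)$.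 Let $\rho:\mathbb C^2\to\mathbb C$ be a bump function along $z_2=0$: a smooth function for which there are open sets $\{z_2=0\}\subset U_1\subset\overline{U_1}\subset U_2$ with $\rho=1$ on $U_1$ and $\rho=0$ off $U_2$, and such that $\pi$ is proper on the support of $\rho$. Let $s_\rho=(s^{(1)}_\rho,s^{(2)}_\rho)$ be the $L_\infty$ map $$s^{(1)}_\rho(\alpha)=\rho\,\pi^*\alpha-\varepsilon\,\frac{\bar\partial\rho}{z_2}\wedge\pi^*\alpha,\qquad s^{(2)}_\rho(\alpha,\beta)=\varepsilon\,\frac{\rho(\rho-1)}{z_2}\,[\pi^*\alpha,\pi^*\beta]$$ from $\Omega^{0,\bullet}_c(\mathbb C_{z_1},\mathfrak g)$ to $\Omega^{0,\bullet}_c(\mathbb C^2,\mathfrak g[\varepsilon])$ with the above differential, and let $s_\rho^*$ be the induced pull-back of cochains, $(s_\rho^*\phi)(\alpha)=\phi\bigl(s^{(1)}_\rho(\alpha)-\tfrac12 s^{(2)}_\rho(\alpha,\alpha)\bigr)$ for odd $\alpha$ (the sign is the one of the shift $L\to L[1]$). Then, as cochains on $\Omega^{0,\bullet}_c(\mathbb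 C_{z_1},\mathfrak g)$, $$s_\rho^*\,\phi^{4d}_\kappa=-\tfrac12\,\phi^{2d}_\kappa=\phi^{2d}_{-\kappa/2}.$$ -/

import Mathlib

open scoped TensorProduct ContDiff

noncomputable section

namespace Currents

/-! ### Grassmann algebras -/

/-- The complex Grassmann algebra on a set `G` of odd generators. -/
abbrev Gr (G : Type) : Type := ExteriorAlgebra ℂ (G →₀ ℂ)

/-- The odd generator with label `g`. -/
def gen {G : Type} (g : G) : Gr G := ExteriorAlgebra.ι ℂ (Finsupp.single g 1)

/-- The algebra map that relabels generators. -/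
def rename {G H : Type} (σ : G → H) : Gr G →ₐ[ℂ] Gr H :=
  ExteriorAlgebra.map (Finsupp.lmapDomain ℂ ℂ σ)

/-- The odd left derivation `∂/∂g`: it sends `g` to `1` and the other generators to `0`. -/
def contract {G : Type} (g : G) : Gr G →ₗ[ℂ] Gr G :=
  CliffordAlgebra.contractLeft (Finsupp.lapply g : (G →₀ ℂ) →ₗ[ℂ] ℂ)

/-- The parity automorphism: it sends every generator to its negative, so it is `(-1)^p` on
elements of degree `p`. -/
def grParity (G : Type) : Gr G →ₐ[ℂ] Gr G := ExteriorAlgebra.map (-LinearMap.id)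

/-! ### Smooth functions on `ℂⁿ` -/

/-- The space `ℂⁿ`. -/
abbrev Cn (n : ℕ) : Type := Fin n → ℂ

/-- The derivative `∂f/∂z_i = (∂f/∂x_i - i ∂f/∂y_i)/2`. -/
def partialZ {n : ℕ} (i : Fin n) (f : Cn n → ℂ) (x : Cn n) : ℂ :=
  (fderiv ℝ f x (Pi.single i 1) - Complex.I * fderiv ℝ f x (Pi.single i Complex.I)) / 2

/-- The derivative `∂f/∂z̄_i = (∂f/∂x_i + i ∂f/∂y_i)/2`. -/
def partialZbar {n : ℕ} (i : Fin n) (f : Cn n → ℂ) (x : Cn n) : ℂ :=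
  (fderiv ℝ f x (Pi.single i 1) + Complex.I * fderiv ℝ f x (Pi.single i Complex.I)) / 2

theorem contDiff_fderiv_const {n : ℕ} {f : Cn n → ℂ} (hf : ContDiff ℝ ∞ f) (v : Cn n) :
    ContDiff ℝ ∞ (fun x => fderiv ℝ f x v) :=
  (hf.fderiv_right (m := ∞) (by simp)).clm_apply contDiff_const

theorem contDiff_partialZ {n : ℕ} (i : Fin n) {f : Cn n → ℂ} (hf : ContDiff ℝ ∞ f) :
    ContDiff ℝ ∞ (partialZ i f) :=
  ((contDiff_fderiv_const hf _).sub
    (contDiff_const.mul (contDiff_fderiv_const hf _))).div_const 2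

theorem contDiff_partialZbar {n : ℕ} (i : Fin n) {f : Cn n → ℂ} (hf : ContDiff ℝ ∞ f) :
    ContDiff ℝ ∞ (partialZbar i f) :=
  ((contDiff_fderiv_const hf _).add
    (contDiff_const.mul (contDiff_fderiv_const hf _))).div_const 2

theorem partialZ_eq_zero {n : ℕ} (i : Fin n) {f : Cn n → ℂ} {x : Cn n}
    (h : fderiv ℝ f x = 0) : partialZ i f x = 0 := by
  simp [partialZ, h]

theorem partialZbar_eq_zero {n : ℕ} (i : Fin n) {f : Cn n → ℂ} {x : Cn n}
    (h : fderiv ℝ f x = 0) : partialZbar i f x = 0 := by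
  simp [partialZbar, h]

theorem fderiv_eq_zero_of_notMem {n : ℕ} {f : Cn n → ℂ} {x : Cn n} (hx : x ∉ tsupport f) :
    fderiv ℝ f x = 0 := by
  by_contra h
  exact hx (support_fderiv_subset ℝ h)

/-- The submodule of complex-valued smooth functions of compact support. -/
def testSpace (n : ℕ) : Submodule ℂ (Cn n → ℂ) where
  carrier := {f | ContDiff ℝ ∞ f ∧ HasCompactSupport f}
  add_mem' hf hg := ⟨hf.1.add hg.1, hf.2.add hg.2⟩
  zero_mem' := ⟨contDiff_const, HasCompactSupport.zero⟩
  smul_mem' c _ hf := ⟨hf.1.const_smul c, hf.2.smul_left (f := fun _ => c)⟩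

/-- The space `C_c^∞(ℂⁿ)`. -/
def TestFun (n : ℕ) : Type := testSpace n

instance (n : ℕ) : AddCommGroup (TestFun n) := inferInstanceAs (AddCommGroup (testSpace n))

instance (n : ℕ) : Module ℂ (TestFun n) := inferInstanceAs (Module ℂ (testSpace n))

theorem TestFun.ext {n : ℕ} {f g : TestFun n} (h : ∀ x, f.1 x = g.1 x) : f = g :=
  Subtype.ext (funext h)

/-- A test function from a smooth function of compact support. -/
def TestFun.mk {n : ℕ} (f : Cn n → ℂ) (h : ContDiff ℝ ∞ f) (h' : HasCompactSupport f) :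
    TestFun n := ⟨f, h, h'⟩

@[simp] theorem TestFun.mk_val {n : ℕ} (f : Cn n → ℂ) (h : ContDiff ℝ ∞ f)
    (h' : HasCompactSupport f) : (TestFun.mk f h h').1 = f := rfl

@[simp] theorem TestFun.add_val {n : ℕ} (f g : TestFun n) : (f + g).1 = f.1 + g.1 := rfl

@[simp] theorem TestFun.smul_val {n : ℕ} (c : ℂ) (f : TestFun n) : (c • f).1 = c • f.1 := rfl

/-- Multiplication of test functions. -/
def mulTest (n : ℕ) : TestFun n →ₗ[ℂ] TestFun n →ₗ[ℂ] TestFun n :=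
  LinearMap.mk₂ ℂ
    (fun f g => TestFun.mk (fun x => f.1 x * g.1 x) (f.2.1.mul g.2.1) f.2.2.mul_right)
    (fun f f' g => TestFun.ext fun x => by simp [add_mul])
    (fun c f g => TestFun.ext fun x => by simp [mul_assoc])
    (fun f g g' => TestFun.ext fun x => by simp [mul_add])
    (fun c f g => TestFun.ext fun x => by simp [mul_left_comm])

/-- The operator `∂/∂z_i` on test functions. -/
def partialTest {n : ℕ} (i : Fin n) : TestFun n →ₗ[ℂ] TestFun n where
  toFun f := TestFun.mk (partialZ i f.1) (contDiff_partialZ i f.2.1) (f.2.2.mono' (by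
    intro x hx
    by_contra h
    exact hx (partialZ_eq_zero i (fderiv_eq_zero_of_notMem h))))
  map_add' f g := TestFun.ext fun x => by
    have hf := (f.2.1.differentiable (by simp)) x
    have hg := (g.2.1.differentiable (by simp)) x
    simp only [partialZ, TestFun.add_val, TestFun.mk_val, fderiv_add hf hg, Pi.add_apply,
      _root_.add_apply]
    ring
  map_smul' c f := TestFun.ext fun x => by
    have hf := (f.2.1.differentiable (by simp)) x
    simp only [partialZ, TestFun.smul_val, TestFun.mk_val, fderiv_const_smul hf c,
      Pi.smul_apply, _root_.smul_apply, smul_eq_mul, RingHom.id_apply]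
    ring

/-- The Lebesgue integral of test functions. -/
def lebesgue (n : ℕ) : TestFun n →ₗ[ℂ] ℂ where
  toFun f := ∫ x, f.1 x
  map_add' f g := MeasureTheory.integral_add
    (f.2.1.continuous.integrable_of_hasCompactSupport f.2.2)
    (g.2.1.continuous.integrable_of_hasCompactSupport g.2.2)
  map_smul' c f := MeasureTheory.integral_const_mul c f.1

/-! ### Superfields

Chevalley--Eilenberg cochains of a dg Lie algebra `L` are functions on the graded space `L[1]`.
Such a function is recorded by its values on superfields, the elements `∑ c_k x_k` of odd total
parity with `x_k ∈ L` and with coefficients `c_k` in a Grassmann algebra of auxiliary parameters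
`θ_1, …, θ_N`, for every `N`; its (graded symmetric) multilinear components are the coefficients
of the monomials in the parameters. The parameters anticommute with the one-forms, so formulas
such as `α ↦ ∫ κ(α ∧ ∂α)` have their literal meaning on superfields, Koszul signs included. -/

/-- Generators of the algebra of `(0,•)`-forms with parameters: `dz̄_i` and `θ_j`. -/
abbrev DolGen (n N : ℕ) : Type := Fin n ⊕ Fin N

/-- Generators of the algebra of all forms with parameters: `dz_i`, and `dz̄_i` and `θ_j`. -/
abbrev FormGen (n N : ℕ) : Type := Fin n ⊕ DolGen n N

/-- `Ω_c^{0,•}(ℂⁿ, 𝔤)` with coefficients in the Grassmann algebra on `θ_1, …, θ_N`. -/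
abbrev Dol (n N : ℕ) (𝔤 : Type*) [AddCommGroup 𝔤] [Module ℂ 𝔤] :=
  TestFun n ⊗[ℂ] (Gr (DolGen n N) ⊗[ℂ] 𝔤)

/-- `Ω_c^{•,•}(ℂⁿ, V)` with coefficients in the Grassmann algebra on `θ_1, …, θ_N`. -/
abbrev Form (n N : ℕ) (V : Type*) [AddCommGroup V] [Module ℂ V] :=
  TestFun n ⊗[ℂ] (Gr (FormGen n N) ⊗[ℂ] V)

section Operations

variable {n N : ℕ} {𝔤 : Type*} [LieRing 𝔤] [LieAlgebra ℂ 𝔤]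

/-- The total parity operator (form degree plus parameter degree). -/
def dolParity (n N : ℕ) (𝔤 : Type*) [LieRing 𝔤] [LieAlgebra ℂ 𝔤] :
    Dol n N 𝔤 →ₗ[ℂ] Dol n N 𝔤 :=
  TensorProduct.map LinearMap.id (TensorProduct.map (grParity (DolGen n N)).toLinearMap LinearMap.id)

/-- The superfields of odd total parity. -/
def OddDol (n N : ℕ) (𝔤 : Type*) [LieRing 𝔤] [LieAlgebra ℂ 𝔤] : Submodule ℂ (Dol n N 𝔤) :=
  LinearMap.eqLocus (dolParity n N 𝔤) (-LinearMap.id)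

/-- The superfields of even total parity. -/
def EvenDol (n N : ℕ) (𝔤 : Type*) [LieRing 𝔤] [LieAlgebra ℂ 𝔤] : Submodule ℂ (Dol n N 𝔤) :=
  LinearMap.eqLocus (dolParity n N 𝔤) LinearMap.id

/-- The inclusion of `(0,•)`-forms in all forms. -/
def toForm : Dol n N 𝔤 →ₗ[ℂ] Form n N 𝔤 :=
  TensorProduct.map LinearMap.id
    (TensorProduct.map (rename (Sum.inr : DolGen n N → FormGen n N)).toLinearMap LinearMap.id)

/-- The bracket `[fωX, gηY] = fg (ω ∧ η) [X, Y]`. -/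
def dolBracket : Dol n N 𝔤 →ₗ[ℂ] Dol n N 𝔤 →ₗ[ℂ] Dol n N 𝔤 :=
  TensorProduct.map₂ (mulTest n)
    (TensorProduct.map₂ (LinearMap.mul ℂ (Gr (DolGen n N)))
      (LieModule.toEnd ℂ 𝔤 𝔤 : 𝔤 →ₗ[ℂ] Module.End ℂ 𝔤))

/-- The operator `∂ = ∑ dz_i ∧ ∂/∂z_i`. -/
def del : Form n N 𝔤 →ₗ[ℂ] Form n N 𝔤 :=
  ∑ i : Fin n, TensorProduct.map (partialTest i)
    (TensorProduct.map (LinearMap.mulLeft ℂ (gen (Sum.inl i : FormGen n N))) LinearMap.id)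

/-- The pairing `κ(fωX ∧ gηY) = fg (ω ∧ η) κ(X, Y)`. -/
def wedgePair (κ : LinearMap.BilinForm ℂ 𝔤) : Form n N 𝔤 →ₗ[ℂ] Form n N 𝔤 →ₗ[ℂ] Form n N ℂ :=
  TensorProduct.map₂ (mulTest n)
    (TensorProduct.map₂ (LinearMap.mul ℂ (Gr (FormGen n N))) κ)

/-- The operation `ω ↦ ω ∧ dz_i`. -/
def wedgeDz (i : Fin n) : Form n N ℂ →ₗ[ℂ] Form n N ℂ :=
  TensorProduct.map LinearMap.id
    (TensorProduct.map (LinearMap.mulRight ℂ (gen (Sum.inl i : FormGen n N))) LinearMap.id)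

/-- The coefficient of `dz_1 ∧ dz̄_1 ∧ ⋯ ∧ dz_n ∧ dz̄_n`, an element of the Grassmann algebra on
`θ_1, …, θ_N`: it is obtained by applying `∂/∂dz̄_i ∘ ∂/∂dz_i` for all `i`. -/
def topCoeff (n N : ℕ) : Gr (FormGen n N) →ₗ[ℂ] Gr (Fin N) :=
  (ExteriorAlgebra.map
      (Finsupp.lcomapDomain (fun j : Fin N => (Sum.inr (Sum.inr j) : FormGen n N))
        (Sum.inr_injective.comp Sum.inr_injective))).toLinearMap ∘ₗ
    ((List.finRange n).map fun i =>
      (contract (Sum.inr (Sum.inl i)) * contract (Sum.inl i) :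
        Module.End ℂ (Gr (FormGen n N)))).prod

/-- Integration of forms over `ℂⁿ`, with values in the Grassmann algebra on `θ_1, …, θ_N`. In the
complex orientation `∫ f dz_1 ∧ dz̄_1 ∧ ⋯ ∧ dz_n ∧ dz̄_n` is `(-2i)ⁿ` times the Lebesgue integral. -/
def integral (n N : ℕ) : Form n N ℂ →ₗ[ℂ] Gr (Fin N) :=
  (TensorProduct.lid ℂ (Gr (Fin N))).toLinearMap ∘ₗ
    TensorProduct.map (((-2 * Complex.I) ^ n) • lebesgue n)
      ((TensorProduct.rid ℂ (Gr (Fin N))).toLinearMap ∘ₗ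
        TensorProduct.map (topCoeff n N) LinearMap.id)

end Operations

/-! ### The cocycles -/

/-- `Sym²(𝔤*)^𝔤`: the invariant symmetric bilinear forms on `𝔤`. -/
def InvSym (𝔤 : Type*) [LieRing 𝔤] [LieAlgebra ℂ 𝔤] :
    Submodule ℂ (LinearMap.BilinForm ℂ 𝔤) where
  carrier := {κ | (∀ X Y, κ X Y = κ Y X) ∧ ∀ X Y Z, κ ⁅X, Y⁆ Z = κ X ⁅Y, Z⁆}
  add_mem' h h' := ⟨fun X Y => by simp [h.1 X Y, h'.1 X Y],
    fun X Y Z => by simp [h.2 X Y Z, h'.2 X Y Z]⟩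
  zero_mem' := ⟨fun _ _ => rfl, fun _ _ _ => rfl⟩
  smul_mem' c _ h := ⟨fun X Y => by simp [h.1 X Y], fun X Y Z => by simp [h.2 X Y Z]⟩

/-- Functions of superfields of `Ω_c^{0,•}(ℂ, 𝔤)`. -/
abbrev Cochain2d (𝔤 : Type*) [LieRing 𝔤] [LieAlgebra ℂ 𝔤] :=
  ∀ N : ℕ, OddDol 1 N 𝔤 → Gr (Fin N)

/-- Functions of superfields `α + ε α'` of `Ω_c^{0,•}(ℂ², 𝔤[ε])`, with `ε` odd. The pair
`(α, α')` stands for `α + ε α'`; so `α` is odd and `α'` is even. -/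
abbrev Cochain4d (𝔤 : Type*) [LieRing 𝔤] [LieAlgebra ℂ 𝔤] :=
  ∀ N : ℕ, OddDol 2 N 𝔤 × EvenDol 2 N 𝔤 → Gr (Fin N)

/-- `φ^{2d}_κ : α ↦ (2πi)⁻¹ ∫_ℂ κ(α ∧ ∂α)`. -/
def phi2d {𝔤 : Type*} [LieRing 𝔤] [LieAlgebra ℂ 𝔤] (κ : InvSym 𝔤) : Cochain2d 𝔤 :=
  fun N α => (2 * Real.pi * Complex.I : ℂ)⁻¹ •
    integral 1 N (wedgePair κ.1 (toForm α.1) (del (toForm α.1)))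

/-- `φ^{(2),i}_κ : α + ε α' ↦ (2πi)⁻² ∫_{ℂ²} κ(α ∧ ∂α') ∧ dz_i`. -/
def phiN2 {𝔤 : Type*} [LieRing 𝔤] [LieAlgebra ℂ 𝔤] (i : Fin 2) (κ : InvSym 𝔤) : Cochain4d 𝔤 :=
  fun N a => ((2 * Real.pi * Complex.I : ℂ) ^ 2)⁻¹ •
    integral 2 N (wedgeDz i (wedgePair κ.1 (toForm a.1.1) (del (toForm a.2.1))))

/-- `φ^{4d}_κ`, the case of the form `dz_2`; the coordinates `(z_1, z_2)` are `(x 0, x 1)`. -/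
def phi4d {𝔤 : Type*} [LieRing 𝔤] [LieAlgebra ℂ 𝔤] (κ : InvSym 𝔤) : Cochain4d 𝔤 :=
  phiN2 1 κ

/-! ### Bump functions along `z_2 = 0` and the `L_∞` map -/

/-- The projection `π : ℂ² → ℂ` to the first coordinate. -/
def proj (x : Cn 2) : Cn 1 := fun _ => x 0

theorem contDiff_proj : ContDiff ℝ ∞ proj :=
  contDiff_pi.2 fun _ => contDiff_apply ℝ ℂ (0 : Fin 2)

/-- A closed set on which `π` is proper. -/
def ProperOver (S : Set (Cn 2)) : Prop :=
  ∀ K : Set (Cn 1), IsCompact K → IsCompact (S ∩ proj ⁻¹' K)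

/-- Bump functions along `z_2 = 0`. The last condition makes `ρ π^*α` compactly supported
for every compactly supported `α`. -/
structure IsBump (ρ : Cn 2 → ℂ) : Prop where
  smooth : ContDiff ℝ ∞ ρ
  nhds : ∃ U₁ U₂ : Set (Cn 2), IsOpen U₁ ∧ IsOpen U₂ ∧ {x | x 1 = 0} ⊆ U₁ ∧
    closure U₁ ⊆ U₂ ∧ (∀ x ∈ U₁, ρ x = 1) ∧ (∀ x ∉ U₂, ρ x = 0)
  proper : ProperOver (tsupport ρ)

/-- Smooth functions on `ℂ²` on whose support `π` is proper. -/
structure VertFun where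
  toFun : Cn 2 → ℂ
  smooth : ContDiff ℝ ∞ toFun
  proper : ProperOver (tsupport toFun)

theorem ProperOver.mono {S T : Set (Cn 2)} (hT : ProperOver T) (hS : IsClosed S) (h : S ⊆ T) :
    ProperOver S := fun K hK =>
  (hT K hK).of_isClosed_subset
    (hS.inter (hK.isClosed.preimage contDiff_proj.continuous))
    (Set.inter_subset_inter_left _ h)

theorem contDiff_div_z2 {u : Cn 2 → ℂ} (hu : ContDiff ℝ ∞ u) {U : Set (Cn 2)} (hU : IsOpen U)
    (h0 : {x : Cn 2 | x 1 = 0} ⊆ U) (hz : ∀ x ∈ U, u x = 0) :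
    ContDiff ℝ ∞ (fun x => u x / x 1) := by
  rw [contDiff_iff_contDiffAt]
  intro x
  by_cases hx : x 1 = 0
  · have : (fun x => u x / x 1) =ᶠ[_root_.nhds x] fun _ => 0 := by
      filter_upwards [hU.mem_nhds (h0 hx)] with y hy
      simp [hz y hy]
    exact contDiffAt_const.congr_of_eventuallyEq this
  · have h1 : ContDiff ℝ ∞ fun y : Cn 2 => y 1 := contDiff_apply ℝ ℂ (1 : Fin 2)
    simp only [div_eq_mul_inv]
    exact hu.contDiffAt.mul (h1.contDiffAt.inv hx)

/-- The function `ρ`. -/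
def IsBump.fn {ρ : Cn 2 → ℂ} (h : IsBump ρ) : VertFun := ⟨ρ, h.smooth, h.proper⟩

/-- The function `z_2⁻¹ ∂ρ/∂z̄_i`, which vanishes near `z_2 = 0`. -/
def IsBump.dbarDiv {ρ : Cn 2 → ℂ} (h : IsBump ρ) (i : Fin 2) : VertFun where
  toFun x := partialZbar i ρ x / x 1
  smooth := by
    obtain ⟨U₁, U₂, h1, -, h0, -, hr, -⟩ := h.nhds
    refine contDiff_div_z2 (contDiff_partialZbar i h.smooth) h1 h0 fun x hx => ?_
    have : ρ =ᶠ[_root_.nhds x] fun _ => 1 := by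
      filter_upwards [h1.mem_nhds hx] with y hy using hr y hy
    exact partialZbar_eq_zero i (by rw [this.fderiv_eq]; simp)
  proper := h.proper.mono (isClosed_tsupport _) (closure_minimal (by
    intro x hx
    by_contra hn
    exact hx (by simp [partialZbar_eq_zero i (fderiv_eq_zero_of_notMem hn)]))
    (isClosed_tsupport _))

/-- The function `ρ(ρ - 1)/z_2`, which vanishes near `z_2 = 0`. -/
def IsBump.corr {ρ : Cn 2 → ℂ} (h : IsBump ρ) : VertFun where
  toFun x := ρ x * (ρ x - 1) / x 1
  smooth := by
    obtain ⟨U₁, U₂, h1, -, h0, -, hr, -⟩ := h.nhds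
    exact contDiff_div_z2 (h.smooth.mul (h.smooth.sub contDiff_const)) h1 h0
      fun x hx => by simp [hr x hx]
  proper := h.proper.mono (isClosed_tsupport _) (closure_minimal (by
    intro x hx
    by_contra hn
    exact hx (by simp [image_eq_zero_of_notMem_tsupport hn]))
    (isClosed_tsupport _))

/-- The map `f ↦ m π^*f` from test functions on `ℂ` to test functions on `ℂ²`. -/
def mulPull (m : VertFun) : TestFun 1 →ₗ[ℂ] TestFun 2 where
  toFun f := TestFun.mk (fun x => m.toFun x * f.1 (proj x))
    (m.smooth.mul (f.2.1.comp contDiff_proj))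
    ((m.proper _ f.2.2).of_isClosed_subset (isClosed_tsupport _) (by
      refine closure_minimal (fun x hx => ⟨?_, ?_⟩)
        ((isClosed_tsupport _).inter
          ((isClosed_tsupport _).preimage contDiff_proj.continuous))
      · exact subset_tsupport _ (left_ne_zero_of_mul hx)
      · exact subset_tsupport _ (right_ne_zero_of_mul hx)))
  map_add' f g := TestFun.ext fun x =>
    mul_add (m.toFun x) (f.1 (proj x)) (g.1 (proj x))
  map_smul' c f := TestFun.ext fun x =>
    mul_left_comm (m.toFun x) c (f.1 (proj x))

section LInfinity

variable {N : ℕ} {𝔤 : Type*} [LieRing 𝔤] [LieAlgebra ℂ 𝔤]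

/-- The inclusion `dz̄_1 ↦ dz̄_1`, `θ_j ↦ θ_j` of generators. -/
def pullGen (N : ℕ) : DolGen 1 N → DolGen 2 N := Sum.map (fun _ => 0) id

/-- The map `α ↦ (m ω) ∧ π^*α`, for `ω` in the algebra generated by `dz̄_1, dz̄_2, θ_j`. -/
def wedgePull (m : VertFun) (w : Gr (DolGen 2 N)) : Dol 1 N 𝔤 →ₗ[ℂ] Dol 2 N 𝔤 :=
  TensorProduct.map (mulPull m)
    (TensorProduct.map (LinearMap.mulLeft ℂ w ∘ₗ (rename (pullGen N)).toLinearMap) LinearMap.id)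

variable {ρ : Cn 2 → ℂ}

/-- The map `α ↦ ρ π^*α`. -/
def IsBump.mulRho (h : IsBump ρ) : Dol 1 N 𝔤 →ₗ[ℂ] Dol 2 N 𝔤 :=
  wedgePull h.fn 1

/-- The map `α ↦ (∂̄ρ / z_2) ∧ π^*α`. -/
def IsBump.wedgeDbarRho (h : IsBump ρ) : Dol 1 N 𝔤 →ₗ[ℂ] Dol 2 N 𝔤 :=
  ∑ i : Fin 2, wedgePull (h.dbarDiv i) (gen (Sum.inl i))

/-- The map `(α, β) ↦ (ρ(ρ - 1)/z_2) [π^*α, π^*β]`. -/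
def IsBump.corrBracket (h : IsBump ρ) (α β : Dol 1 N 𝔤) : Dol 2 N 𝔤 :=
  wedgePull h.corr 1 (dolBracket α β)

/-- The unary component `s^{(1)}(α) = ρ π^*α - ε (∂̄ρ/z_2) ∧ π^*α`, as a pair. -/
def IsBump.s1 (h : IsBump ρ) (α : Dol 1 N 𝔤) : Dol 2 N 𝔤 × Dol 2 N 𝔤 :=
  (h.mulRho α, -h.wedgeDbarRho α)

/-- The binary component `s^{(2)}(α, β) = ε (ρ(ρ - 1)/z_2) [π^*α, π^*β]`, as a pair. -/
def IsBump.s2 (h : IsBump ρ) (α β : Dol 1 N 𝔤) : Dol 2 N 𝔤 × Dol 2 N 𝔤 :=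
  (0, h.corrBracket α β)

theorem rename_grParity {G H : Type} (σ : G → H) (x : Gr G) :
    grParity H (rename σ x) = rename σ (grParity G x) := by
  have : (grParity H).comp (rename σ) = (rename σ).comp (grParity G) := by
    simp only [grParity, rename, ExteriorAlgebra.map_comp_map, LinearMap.comp_neg,
      LinearMap.neg_comp, LinearMap.id_comp, LinearMap.comp_id]
  exact DFunLike.congr_fun this x

theorem grParity_gen {G : Type} (g : G) : grParity G (gen g) = -gen g := by
  simp only [grParity, gen, ExteriorAlgebra.map_apply_ι, LinearMap.neg_apply, LinearMap.id_apply,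
    map_neg]

theorem dolParity_wedgePull (m : VertFun) (w : Gr (DolGen 2 N)) (α : Dol 1 N 𝔤) :
    dolParity 2 N 𝔤 (wedgePull m w α) =
      wedgePull m (grParity _ w) (dolParity 1 N 𝔤 α) := by
  induction α using TensorProduct.induction_on with
  | zero => simp
  | add x y hx hy => simp only [map_add, hx, hy]
  | tmul f y =>
    induction y using TensorProduct.induction_on with
    | zero => simp
    | add x y hx hy => simp only [TensorProduct.tmul_add, map_add, hx, hy]
    | tmul η X => simp [dolParity, wedgePull, rename_grParity]

theorem dolParity_bracket {n : ℕ} (α β : Dol n N 𝔤) :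
    dolParity n N 𝔤 (dolBracket α β) = dolBracket (dolParity n N 𝔤 α) (dolParity n N 𝔤 β) := by
  induction α using TensorProduct.induction_on with
  | zero => simp
  | add x y hx hy => simp only [map_add, LinearMap.add_apply, hx, hy]
  | tmul f y =>
  induction y using TensorProduct.induction_on with
  | zero => simp
  | add x y hx hy => simp only [TensorProduct.tmul_add, map_add, LinearMap.add_apply, hx, hy]
  | tmul η X =>
  induction β using TensorProduct.induction_on with
  | zero => simp
  | add x y hx hy => simp only [map_add, hx, hy]
  | tmul g z =>
  induction z using TensorProduct.induction_on with
  | zero => simp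
  | add x y hx hy => simp only [TensorProduct.tmul_add, map_add, hx, hy]
  | tmul ζ Y => simp [dolParity, dolBracket, TensorProduct.map₂_apply_tmul]

theorem wedgePull_neg (m : VertFun) (w : Gr (DolGen 2 N)) (α : Dol 1 N 𝔤) :
    wedgePull m (-w) α = -wedgePull m w α := by
  induction α using TensorProduct.induction_on with
  | zero => simp
  | add x y hx hy => simp only [map_add, hx, hy, neg_add]
  | tmul f y =>
    induction y using TensorProduct.induction_on with
    | zero => simp
    | add x y hx hy => simp only [TensorProduct.tmul_add, map_add, hx, hy, neg_add]
    | tmul η X => simp [wedgePull, TensorProduct.neg_tmul, TensorProduct.tmul_neg]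

theorem dolParity_odd {n : ℕ} (α : OddDol n N 𝔤) : dolParity n N 𝔤 α.1 = -α.1 := α.2

/-- The map of superfields `α ↦ s^{(1)}(α) - ½ s^{(2)}(α, α)` given by the `L_∞` map
`(s^{(1)}, s^{(2)})`. In the convention
`[s^{(1)}α, s^{(1)}β] - s^{(1)}[α, β] = D s^{(2)}(α, β) - s^{(2)}(∂̄α, β) - (-1)^{|α|} s^{(2)}(α, ∂̄β)`
the sign is the one of the shift `L → L[1]`, and the map sends Maurer--Cartan elements to
Maurer--Cartan elements. -/
def IsBump.s (h : IsBump ρ) (α : OddDol 1 N 𝔤) : OddDol 2 N 𝔤 × EvenDol 2 N 𝔤 :=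
  let a := h.s1 α.1 - (1 / 2 : ℂ) • h.s2 α.1 α.1
  (⟨a.1, by
      change dolParity 2 N 𝔤 a.1 = -a.1
      simp only [a, s1, s2, mulRho, Prod.fst_sub, Prod.smul_fst, smul_zero, sub_zero]
      rw [dolParity_wedgePull, map_one, dolParity_odd α, map_neg]⟩,
    ⟨a.2, by
      change dolParity 2 N 𝔤 a.2 = a.2
      simp only [a, s1, s2, wedgeDbarRho, corrBracket, Prod.snd_sub, Prod.smul_snd, map_sub,
        map_neg, map_smul, LinearMap.sum_apply, map_sum, dolParity_wedgePull, map_one,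
        grParity_gen, dolParity_bracket, dolParity_odd α, LinearMap.neg_apply, neg_neg,
        wedgePull_neg]⟩)

/-- The pull-back of cochains along the `L_∞` map. -/
def IsBump.pullback (h : IsBump ρ) (φ : Cochain4d 𝔤) : Cochain2d 𝔤 :=
  fun N α => φ N (h.s α)

end LInfinity

end Currents

end

open scoped TensorProduct ContDiff

namespace Currents

/-! ### The Cauchy–Pompeiu formula in the plane. -/

section CauchyPompeiu

open MeasureTheory Complex Set

/-! Substituting `s_ρ(α)` into the 4d cocycle pairs `ρ π^*α` with `∂` of the `ε`-component
`-(∂̄ρ/z_2) ∧ π^*α - ½ (ρ(ρ-1)/z_2) π^*[α, α]`. A nonzero integral over `ℂ²` needs a factor `dz̄_2`,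
and the only source of one is the summand `∂ρ/∂z̄_2 dz̄_2` of `∂̄ρ`. Hence the `s^{(2)}` term
contributes nothing (`integral_wedgePull_one_del`), and neither does the `dz̄_1` part of `∂̄ρ`. The
factor `dz_2` of the cocycle leaves only `dz_1 ∂/∂z_1` of `∂`.

By the Leibniz rule this derivative falls either on `z_2⁻¹ ∂ρ/∂z̄_2` or on `π^*α`. The first case
gives a functional of `κ(α ∧ α)`, which vanishes because `κ` is symmetric and `α` is odd
(`dolPair_self`). In the second case one integrates along the fibres of `π`. The fibre integral of
`ρ ∂̄ρ/z_2 = ½ ∂̄(ρ²)/z_2` is `-π/2` by Cauchy–Pompeiu and `ρ = 1` on `z_2 = 0`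
(`IsBump.integral_fibre`), independently of the choice of `ρ` and of the base point. What remains is
a multiple of the 2d cocycle.

The signs come from moving `dz_2` and `dz̄_2` through forms and parameters
(`topCoeff_two_dz_dzbar`); `IsBump.integral_wedgeDbarRho` combines them with the analysis. -/

theorem hasDerivAt_radial (θ r : ℝ) :
    HasDerivAt (fun t : ℝ => (t : ℂ) * exp (θ * I)) (exp (θ * I)) r := by
  simpa using (ofRealCLM.hasDerivAt (x := r)).mul_const (exp (θ * I))

theorem hasDerivAt_angular (r θ : ℝ) :
    HasDerivAt (fun t : ℝ => (r : ℂ) * exp (t * I)) (r * (I * exp (θ * I))) θ := by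
  have h := (((ofRealCLM.hasDerivAt (x := θ)).mul_const I).cexp).const_mul (r : ℂ)
  simpa [mul_comm I] using h

theorem integrableOn_polar {F : ℝ × ℝ → ℂ} (hF : Continuous F) {R : ℝ}
    (h0 : ∀ p : ℝ × ℝ, R < p.1 → F p = 0) :
    IntegrableOn F (Ioi 0 ×ˢ Ioo (-Real.pi) Real.pi) := by
  have hK : IsCompact (Icc 0 R ×ˢ Icc (-Real.pi) Real.pi) := isCompact_Icc.prod isCompact_Icc
  refine (hF.continuousOn.integrableOn_compact hK).of_forall_sdiff_eq_zero
    (measurableSet_Ioi.prod measurableSet_Ioo) fun p hp => h0 p ?_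
  by_contra! h
  exact hp.2 ⟨⟨hp.1.1.le, h⟩, hp.1.2.1.le, hp.1.2.2.le⟩

/-- The Cauchy--Pompeiu formula at the origin for functions of compact support. -/
theorem integral_dbar_div {g : ℂ → ℂ} (hg : ContDiff ℝ 1 g) (hc : HasCompactSupport g) :
    ∫ w : ℂ, (fderiv ℝ g w 1 + I * fderiv ℝ g w I) / 2 / w = -Real.pi * g 0 := by
  have hgd : Differentiable ℝ g := hg.differentiable (by simp)
  have hgc : Continuous (fderiv ℝ g) := hg.continuous_fderiv (by simp)
  obtain ⟨R, hR⟩ := hc.isBounded.exists_norm_le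
  have hsup : ∀ p : ℝ × ℝ, max R 0 < p.1 → (p.1 : ℂ) * exp (p.2 * I) ∉ tsupport g := by
    intro p hp hm
    have h1 := hR _ hm
    rw [norm_mul, norm_exp_ofReal_mul_I, mul_one, norm_real, Real.norm_eq_abs] at h1
    have := le_abs_self p.1
    have := le_max_left R 0
    linarith
  have hD : ∀ p : ℝ × ℝ, max R 0 < p.1 → fderiv ℝ g ((p.1 : ℂ) * exp (p.2 * I)) = 0 := by
    intro p hp
    by_contra h
    exact hsup p hp (support_fderiv_subset ℝ h)
  let A : ℝ × ℝ → ℂ := fun p => fderiv ℝ g (p.1 * exp (p.2 * I)) (exp (p.2 * I))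
  let B : ℝ × ℝ → ℂ := fun p => fderiv ℝ g (p.1 * exp (p.2 * I)) (I * exp (p.2 * I))
  have hcont : Continuous fun p : ℝ × ℝ => (p.1 : ℂ) * exp (p.2 * I) := by fun_prop
  have hA : Continuous A := (hgc.comp hcont).clm_apply (by fun_prop)
  have hB : Continuous B := (hgc.comp hcont).clm_apply (by fun_prop)
  have hAi := integrableOn_polar hA (R := max R 0) fun p hp => by simp only [A, hD p hp]; simp
  have hBi := integrableOn_polar hB (R := max R 0) fun p hp => by simp only [B, hD p hp]; simp
  have e1 : ∫ w : ℂ, (fderiv ℝ g w 1 + I * fderiv ℝ g w I) / 2 / w =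
      ∫ p in Ioi (0 : ℝ) ×ˢ Ioo (-Real.pi) Real.pi, ((1 / 2 : ℂ) * A p + (I / 2) * B p) := by
    -- In polar coordinates `∂̄ = ½ e^{iθ} (∂_r + (i/r) ∂_θ)`, so the Jacobian `r` cancels the
    -- singularity of `1/w = e^{-iθ}/r`. Here `A` is `∂_r g` and `B` is `r⁻¹ ∂_θ g`, both continuous
    -- up to `r = 0`.
    rw [← Complex.integral_comp_polarCoord_symm]
    refine setIntegral_congr_fun (measurableSet_Ioi.prod measurableSet_Ioo) fun p hp => ?_
    have hp0 : (p.1 : ℂ) ≠ 0 := ofReal_ne_zero.2 (ne_of_gt hp.1)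
    have hs : Complex.polarCoord.symm p = p.1 * exp (p.2 * I) := by
      rw [Complex.polarCoord_symm_apply, exp_mul_I, ofReal_cos, ofReal_sin]
    have hv : ∀ (L : ℂ →L[ℝ] ℂ) (v : ℂ), L v = v.re * L 1 + v.im * L I := by
      intro L v
      conv_lhs => rw [show v = v.re • (1 : ℂ) + v.im • I by simp [re_add_im]]
      rw [map_add, map_smul, map_smul, real_smul, real_smul]
    have hr : exp (p.2 * I) = Real.cos p.2 + Real.sin p.2 * I := by
      rw [exp_mul_I, ofReal_cos, ofReal_sin]
    have hcs : (Real.cos p.2 : ℂ) ^ 2 + (Real.sin p.2 : ℂ) ^ 2 = 1 := by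
      exact_mod_cast Real.cos_sq_add_sin_sq p.2
    simp only [hs, A, B, real_smul]
    rw [hv _ (exp (p.2 * I)), hv _ (I * exp (p.2 * I)), exp_ofReal_mul_I_re,
      exp_ofReal_mul_I_im]
    have e3 : (I * exp (p.2 * I)).re = -Real.sin p.2 := by simp [exp_ofReal_mul_I_im]
    have e4 : (I * exp (p.2 * I)).im = Real.cos p.2 := by simp [exp_ofReal_mul_I_re]
    rw [e3, e4]
    generalize fderiv ℝ g (p.1 * exp (p.2 * I)) 1 = a
    generalize fderiv ℝ g (p.1 * exp (p.2 * I)) I = b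
    have hne := exp_ne_zero (p.2 * I)
    field_simp
    rw [mul_comm I (p.2 : ℂ), hr]
    push_cast at hcs ⊢
    linear_combination (-(a + I * b)) * hcs + (sin p.2 ^ 2 * a - cos p.2 * sin p.2 * b) * I_sq
  -- On each ray the fundamental theorem of calculus gives `-g 0`, since `g` vanishes far out; the
  -- angles contribute the length `2π`.
  have hAv : ∫ p in Ioi (0 : ℝ) ×ˢ Ioo (-Real.pi) Real.pi, A p = -(2 * Real.pi) * g 0 := by
    have hr : ∀ θ : ℝ, ∫ r in Ioi (0 : ℝ), A (r, θ) = -g 0 := by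
      intro θ
      have hd : ∀ r : ℝ, HasDerivAt (fun r : ℝ => g (r * exp (θ * I))) (A (r, θ)) r := fun r =>
        (hgd _).hasFDerivAt.comp_hasDerivAt r (hasDerivAt_radial θ r)
      have h1 : (fun r : ℝ => g (r * exp (θ * I))) =ᶠ[Filter.atTop] fun _ => 0 := by
        filter_upwards [Filter.eventually_gt_atTop (max R 0)] with r h
        exact image_eq_zero_of_notMem_tsupport (hsup (r, θ) h)
      have hcθ : Continuous fun r : ℝ => A (r, θ) := hA.comp (by fun_prop)
      have hi : IntegrableOn (fun r : ℝ => A (r, θ)) (Ioi 0) := by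
        refine (hcθ.continuousOn.integrableOn_compact
          (isCompact_Icc (a := 0) (b := max R 0))).of_forall_sdiff_eq_zero measurableSet_Ioi
          fun r hr => ?_
        have : max R 0 < r := by
          by_contra! h
          exact hr.2 ⟨(mem_Ioi.1 hr.1).le, h⟩
        simp only [A, hD (r, θ) this]
        simp
      rw [integral_Ioi_of_hasDerivAt_of_tendsto' (fun r _ => hd r) hi
        (tendsto_const_nhds.congr' h1.symm)]
      simp
    rw [Measure.volume_eq_prod, ← Measure.prod_restrict, integral_prod_symm]
    · simp only [hr]
      rw [setIntegral_const, Real.volume_real_Ioo_of_le (by linarith [Real.pi_pos]), real_smul]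
      push_cast
      ring
    · rw [Measure.prod_restrict, ← Measure.volume_eq_prod]
      exact hAi
  -- On each circle `r B` is the derivative of a `2π`-periodic function of the angle, so its
  -- integral over a period is zero.
  have hBv : ∫ p in Ioi (0 : ℝ) ×ˢ Ioo (-Real.pi) Real.pi, B p = 0 := by
    rw [Measure.volume_eq_prod, ← Measure.prod_restrict, integral_prod]
    · refine integral_eq_zero_of_ae ?_
      filter_upwards [ae_restrict_mem measurableSet_Ioi] with r hr
      have hr0 : (r : ℂ) ≠ 0 := ofReal_ne_zero.2 (ne_of_gt hr)
      have hd : ∀ θ : ℝ, HasDerivAt (fun θ : ℝ => g (r * exp (θ * I))) (r * B (r, θ)) θ := by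
        intro θ
        have h := (hgd _).hasFDerivAt.comp_hasDerivAt θ (hasDerivAt_angular r θ)
        have hl : ∀ (L : ℂ →L[ℝ] ℂ) (v : ℂ), L (r * v) = r * L v := fun L v => by
          rw [← real_smul, map_smul, real_smul]
        rwa [hl] at h
      have hcr : Continuous fun θ : ℝ => (r : ℂ) * B (r, θ) := by
        have : Continuous fun θ : ℝ => B (r, θ) := hB.comp (by fun_prop)
        fun_prop
      have h := intervalIntegral.integral_eq_sub_of_hasDerivAt (fun θ _ => hd θ)
        (hcr.intervalIntegrable (-Real.pi) Real.pi)
      have hπ : exp ((-Real.pi : ℝ) * I) = exp (Real.pi * I) := by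
        rw [ofReal_neg, neg_mul, exp_neg_pi_mul_I, exp_pi_mul_I]
      rw [hπ, sub_self, intervalIntegral.integral_const_mul] at h
      rw [Pi.zero_apply, ← integral_Ioc_eq_integral_Ioo,
        ← intervalIntegral.integral_of_le (by linarith [Real.pi_pos])]
      exact (mul_eq_zero.1 h).resolve_left hr0
    · rw [Measure.prod_restrict, ← Measure.volume_eq_prod]
      exact hBi
  rw [e1, integral_add (hAi.const_mul _) (hBi.const_mul _), integral_const_mul,
    integral_const_mul, hAv, hBv]
  ring

end CauchyPompeiu

/-! ### Leibniz rule and integration along the fibres of `π`. -/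

section FibreIntegration

open MeasureTheory Set

/-- The product of functions with vertically proper support. -/
noncomputable def VertFun.mul (m m' : VertFun) : VertFun where
  toFun x := m.toFun x * m'.toFun x
  smooth := m.smooth.mul m'.smooth
  proper := m.proper.mono (isClosed_tsupport _) (tsupport_mul_subset_left (f := m.toFun))

/-- The derivative `∂m/∂z_i` of a function with vertically proper support. -/
noncomputable def VertFun.partialZ (i : Fin 2) (m : VertFun) : VertFun where
  toFun := Currents.partialZ i m.toFun
  smooth := contDiff_partialZ i m.smooth
  proper := m.proper.mono (isClosed_tsupport _) (closure_minimal (by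
    intro x hx
    by_contra h
    exact hx (partialZ_eq_zero i (fderiv_eq_zero_of_notMem h))) (isClosed_tsupport _))

theorem fderiv_comp_proj {f : Cn 1 → ℂ} (hf : ContDiff ℝ ∞ f) (x v : Cn 2) :
    fderiv ℝ (fun y => f (proj y)) x v = fderiv ℝ f (proj x) (proj v) := by
  let L : Cn 2 →L[ℝ] Cn 1 := ContinuousLinearMap.pi fun _ => ContinuousLinearMap.proj 0
  have h := ((hf.differentiable (by simp)) (L x)).hasFDerivAt.comp x L.hasFDerivAt
  have h' : HasFDerivAt (fun y => f (proj y)) ((fderiv ℝ f (proj x)).comp L) x := h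
  rw [h'.fderiv]
  rfl

theorem proj_single (c : ℂ) : proj (Pi.single 0 c) = Pi.single 0 c := by
  funext i
  fin_cases i
  simp [proj]

theorem partialZ_comp_proj {f : Cn 1 → ℂ} (hf : ContDiff ℝ ∞ f) (x : Cn 2) :
    partialZ 0 (fun y => f (proj y)) x = partialZ 0 f (proj x) := by
  simp only [partialZ, fderiv_comp_proj hf, proj_single]

theorem partialZ_mul {n : ℕ} (i : Fin n) {f g : Cn n → ℂ} (hf : ContDiff ℝ ∞ f)
    (hg : ContDiff ℝ ∞ g) (x : Cn n) :
    partialZ i (fun y => f y * g y) x = f x * partialZ i g x + partialZ i f x * g x := by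
  have h := fderiv_mul ((hf.differentiable (by simp)) x) ((hg.differentiable (by simp)) x)
  have h' : fderiv ℝ (fun y => f y * g y) x = f x • fderiv ℝ g x + g x • fderiv ℝ f x := h
  simp only [partialZ, h', _root_.add_apply, _root_.smul_apply, smul_eq_mul]
  ring

theorem partialZbar_mul_self {n : ℕ} (i : Fin n) {f : Cn n → ℂ} (hf : ContDiff ℝ ∞ f)
    (x : Cn n) : partialZbar i (fun y => f y * f y) x = 2 * (f x * partialZbar i f x) := by
  have h := fderiv_mul ((hf.differentiable (by simp)) x) ((hf.differentiable (by simp)) x)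
  have h' : fderiv ℝ (fun y => f y * f y) x = f x • fderiv ℝ f x + f x • fderiv ℝ f x := h
  simp only [partialZbar, h', _root_.add_apply, _root_.smul_apply, smul_eq_mul]
  ring

/-- The Leibniz rule for `mπ^*f · ∂/∂z_1 (m'π^*g)`. -/
theorem mulTest_mulPull_partialTest (m m' : VertFun) (f g : TestFun 1) :
    mulTest 2 (mulPull m f) (partialTest 0 (mulPull m' g)) =
      mulPull (m.mul m') (mulTest 1 f (partialTest 0 g)) +
        mulPull (m.mul (m'.partialZ 0)) (mulTest 1 f g) := by
  have key : ∀ {u v : Cn 1 → ℂ}, ContDiff ℝ ∞ v → ∀ x : Cn 2,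
      m.toFun x * u (proj x) * partialZ 0 (fun y => m'.toFun y * v (proj y)) x =
        m.toFun x * m'.toFun x * (u (proj x) * partialZ 0 v (proj x)) +
          m.toFun x * partialZ 0 m'.toFun x * (u (proj x) * v (proj x)) := by
    intro u v hv x
    rw [partialZ_mul 0 m'.smooth (g := fun y => v (proj y)) (hv.comp contDiff_proj) x, partialZ_comp_proj hv]
    ring
  exact TestFun.ext fun x => key g.2.1 x

/-- Integration along the fibres of `π`, for functions with constant fibre integral. -/
theorem integral_mul_comp_proj {m : Cn 2 → ℂ} {u : Cn 1 → ℂ}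
    (hi : Integrable fun x => m x * u (proj x)) {c : ℂ}
    (hc : ∀ z : ℂ, ∫ w : ℂ, m ![z, w] = c) :
    ∫ x, m x * u (proj x) = c * ∫ x, u x := by
  have e2 := (volume_preserving_finTwoArrow ℂ).symm
  have e1 := (volume_preserving_funUnique (Fin 1) ℂ).symm
  have hf : ∀ z w : ℂ, m (MeasurableEquiv.finTwoArrow.symm (z, w)) *
      u (proj (MeasurableEquiv.finTwoArrow.symm (z, w))) =
      u ((MeasurableEquiv.funUnique (Fin 1) ℂ).symm z) * m ![z, w] := by
    intro z w
    rw [mul_comm]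
    rfl
  have hu : ∫ x, u x = ∫ z : ℂ, u ((MeasurableEquiv.funUnique (Fin 1) ℂ).symm z) :=
    (e1.integral_comp' u).symm
  rw [← e2.integral_comp', hu, Measure.volume_eq_prod, integral_prod]
  · simp only [hf, integral_const_mul, hc]
    rw [integral_mul_const, mul_comm]
  · rw [← Measure.volume_eq_prod]
    exact (e2.integrable_comp_emb (MeasurableEquiv.measurableEmbedding _)).2 hi

theorem lebesgue_mulPull (m : VertFun) {c : ℂ} (hc : ∀ z : ℂ, ∫ w : ℂ, m.toFun ![z, w] = c)
    (f : TestFun 1) : lebesgue 2 (mulPull m f) = c * lebesgue 1 f :=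
  integral_mul_comp_proj
    ((mulPull m f).2.1.continuous.integrable_of_hasCompactSupport (mulPull m f).2.2) hc

end FibreIntegration

/-! ### The fibre integral attached to a bump function. -/

section BumpFibre

open MeasureTheory Set

variable {ρ : Cn 2 → ℂ}

theorem IsBump.eq_one (h : IsBump ρ) (z : ℂ) : ρ ![z, 0] = 1 := by
  obtain ⟨U₁, U₂, -, -, h0, -, hr, -⟩ := h.nhds
  exact hr _ (h0 (by simp))

theorem hasFDerivAt_vec_snd (z w : ℂ) :
    HasFDerivAt (fun w : ℂ => (![z, w] : Cn 2))
      (ContinuousLinearMap.single ℝ (fun _ : Fin 2 => ℂ) 1) w := by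
  have h := (ContinuousLinearMap.single ℝ (fun _ : Fin 2 => ℂ) 1).hasFDerivAt (x := w)
  have := h.const_add (![z, 0] : Cn 2)
  refine this.congr_of_eventuallyEq (Filter.Eventually.of_forall fun w => ?_)
  funext i
  fin_cases i <;> simp

theorem contDiff_vec_snd (z : ℂ) : ContDiff ℝ ∞ (fun w : ℂ => (![z, w] : Cn 2)) := by
  refine contDiff_pi.2 fun i => ?_
  fin_cases i
  · exact contDiff_const
  · exact contDiff_id

/-- On a fibre the integrand is `½ ∂̄(ρ²)/w`, so Cauchy–Pompeiu for `ρ²` yields `½ · (-π) · ρ(z,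
0)²`. Only the value of `ρ` on `z_2 = 0` enters. -/
theorem IsBump.integral_fibre (h : IsBump ρ) (z : ℂ) :
    ∫ w : ℂ, (h.fn.mul (h.dbarDiv 1)).toFun ![z, w] = -Real.pi / 2 := by
  let g : ℂ → ℂ := fun w => ρ ![z, w] * ρ ![z, w]
  have hρ2 : ContDiff ℝ ∞ fun x => ρ x * ρ x := h.smooth.mul h.smooth
  have hg : ContDiff ℝ ∞ g := hρ2.comp (contDiff_vec_snd z)
  have hc : HasCompactSupport g := by
    -- Properness of `π` over the single point `z` gives compact support in the fibre.
    have hK : IsCompact ((fun x : Cn 2 => x 1) '' (tsupport ρ ∩ proj ⁻¹' {fun _ => z})) :=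
      (h.proper _ isCompact_singleton).image (continuous_apply 1)
    refine HasCompactSupport.intro hK fun w hw => ?_
    have : ρ ![z, w] = 0 := by
      by_contra hne
      exact hw ⟨![z, w], ⟨subset_tsupport _ hne, by
        funext i
        simp [proj]⟩, by simp⟩
    simp [g, this]
  have hd : ∀ w v : ℂ, fderiv ℝ g w v = fderiv ℝ (fun x => ρ x * ρ x) ![z, w] (Pi.single 1 v) := by
    intro w v
    have h1 := ((hρ2.differentiable (by simp)) ![z, w]).hasFDerivAt.comp w
      (hasFDerivAt_vec_snd z w)
    have h2 : HasFDerivAt g _ w := h1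
    rw [h2.fderiv]
    simp
  have hp : ∀ w : ℂ, (h.fn.mul (h.dbarDiv 1)).toFun ![z, w] =
      (1 / 2) * ((fderiv ℝ g w 1 + Complex.I * fderiv ℝ g w Complex.I) / 2 / w) := by
    intro w
    have h1 := partialZbar_mul_self 1 h.smooth ![z, w]
    rw [partialZbar, ← hd, ← hd] at h1
    rw [h1]
    change ρ ![z, w] * (partialZbar 1 ρ ![z, w] / w) = _
    ring
  simp only [hp]
  rw [integral_const_mul, integral_dbar_div (hg.of_le (by simp)) hc]
  simp only [g, h.eq_one]
  ring

end BumpFibre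

/-! ### Sign rules, relabelling and contraction in Grassmann algebras. -/

section Grassmann

variable {G H : Type}

theorem ι_mul (m : G →₀ ℂ) (x : Gr G) :
    ExteriorAlgebra.ι ℂ m * x = grParity G x * ExteriorAlgebra.ι ℂ m := by
  induction x using ExteriorAlgebra.induction with
  | algebraMap r => simp [Algebra.commutes]
  | ι v =>
    have h := ExteriorAlgebra.ι_add_mul_swap (R := ℂ) m v
    simp only [grParity, ExteriorAlgebra.map_apply_ι, LinearMap.neg_apply, LinearMap.id_apply,
      map_neg, neg_mul]
    exact eq_neg_of_add_eq_zero_left h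
  | mul a b ha hb => rw [← mul_assoc, ha, mul_assoc, hb, map_mul, mul_assoc]
  | add a b ha hb => rw [mul_add, ha, hb, map_add, add_mul]

theorem gen_mul (g : G) (x : Gr G) : gen g * x = grParity G x * gen g := ι_mul _ x

theorem grParity_grParity (x : Gr G) : grParity G (grParity G x) = x := by
  have : (grParity G).comp (grParity G) = AlgHom.id ℂ _ := by
    have h : (-LinearMap.id : (G →₀ ℂ) →ₗ[ℂ] (G →₀ ℂ)) ∘ₗ (-LinearMap.id) = LinearMap.id :=
      LinearMap.ext fun m => by simp
    rw [grParity, ExteriorAlgebra.map_comp_map, h, ExteriorAlgebra.map_id]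
  exact DFunLike.congr_fun this x

theorem mul_gen (g : G) (x : Gr G) : x * gen g = gen g * grParity G x := by
  rw [gen_mul, grParity_grParity]

theorem gen_mul_self (g : G) : gen g * gen g = 0 := ExteriorAlgebra.ι_sq_zero _

/-- Odd elements commute with the others up to the parity automorphism. -/
theorem mul_eq_of_odd {y : Gr G} (hy : grParity G y = -y) (x : Gr G) :
    x * y = y * grParity G x := by
  induction x using ExteriorAlgebra.induction with
  | algebraMap r => simp [Algebra.commutes]
  | ι v =>
    rw [ι_mul, hy]
    simp [grParity]
  | mul a b ha hb => rw [mul_assoc, hb, ← mul_assoc, ha, map_mul, mul_assoc]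
  | add a b ha hb => rw [add_mul, ha, hb, map_add, mul_add]

theorem rename_gen (σ : G → H) (g : G) : rename σ (gen g) = gen (σ g) := by
  simp [rename, gen, Finsupp.lmapDomain_apply]

theorem rename_rename {K : Type} (τ : H → K) (σ : G → H) (x : Gr G) :
    rename τ (rename σ x) = rename (τ ∘ σ) x := by
  have : (rename τ).comp (rename σ) = rename (τ ∘ σ) := by
    rw [rename, rename, rename, ExteriorAlgebra.map_comp_map, Finsupp.lmapDomain_comp]
  exact DFunLike.congr_fun this x

theorem contract_algebraMap (g : G) (r : ℂ) : contract g (algebraMap ℂ (Gr G) r) = 0 :=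
  CliffordAlgebra.contractLeft_algebraMap _ _ _

theorem contract_ι_mul (g : G) (m : G →₀ ℂ) (x : Gr G) :
    contract g (ExteriorAlgebra.ι ℂ m * x) = m g • x - ExteriorAlgebra.ι ℂ m * contract g x :=
  CliffordAlgebra.contractLeft_ι_mul _ _ _

theorem rename_ι_mul (σ : G → H) (m : G →₀ ℂ) (x : Gr G) :
    rename σ (ExteriorAlgebra.ι ℂ m * x) =
      ExteriorAlgebra.ι ℂ (Finsupp.mapDomain σ m) * rename σ x := by
  rw [map_mul, rename, ExteriorAlgebra.map_apply_ι]
  rfl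

/-- Adding one vector on the left at a time matches the rule `contract_ι_mul`, which expands a
contraction only along a left factor of degree one. -/
theorem gr_left_induction {P : Gr G → Prop} (algebraMap : ∀ r : ℂ, P (algebraMap ℂ (Gr G) r))
    (add : ∀ x y, P x → P y → P (x + y))
    (ι_mul : ∀ x m, P x → P (ExteriorAlgebra.ι ℂ m * x)) (x : Gr G) : P x :=
  CliffordAlgebra.left_induction 0 (P := P) algebraMap add ι_mul x

theorem contract_gen_mul (g h : G) (x : Gr G) :
    contract g (gen h * x) = (Finsupp.single h (1 : ℂ)) g • x - gen h * contract g x :=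
  contract_ι_mul _ _ _

theorem contract_gen_mul_self (g : G) (x : Gr G) :
    contract g (gen g * x) = x - gen g * contract g x := by
  simp [contract_gen_mul]

theorem contract_gen_mul_of_ne {g h : G} (hne : h ≠ g) (x : Gr G) :
    contract g (gen h * x) = - (gen h * contract g x) := by
  simp [contract_gen_mul, hne]

theorem contract_rename_eq_zero {σ : G → H} {h : H} (hh : ∀ g, σ g ≠ h) (x : Gr G) :
    contract h (rename σ x) = 0 := by
  induction x using gr_left_induction with
  | algebraMap r => rw [AlgHom.commutes, contract_algebraMap]
  | add a b ha hb => rw [map_add, map_add, ha, hb, add_zero]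
  | ι_mul x m hx =>
    rw [rename_ι_mul, contract_ι_mul, hx, mul_zero, sub_zero,
      Finsupp.mapDomain_of_notMem_range _ _ (by rintro ⟨g, hg⟩; exact hh g hg), zero_smul]

theorem contract_rename {σ : G → H} (hσ : Function.Injective σ) (g : G) (x : Gr G) :
    contract (σ g) (rename σ x) = rename σ (contract g x) := by
  induction x using gr_left_induction with
  | algebraMap r => rw [AlgHom.commutes, contract_algebraMap, contract_algebraMap, map_zero]
  | add a b ha hb => simp only [map_add, ha, hb]
  | ι_mul x m hx =>
    rw [rename_ι_mul, contract_ι_mul, contract_ι_mul, hx, Finsupp.mapDomain_apply hσ, map_sub,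
      map_smul, rename_ι_mul]

end Grassmann

/-! ### Top coefficients on `ℂ²` in terms of those on `ℂ`. -/

section TopCoefficient

variable {N : ℕ}

/-- The inclusion of the generators `dz_1`, `dz̄_1`, `θ_j`. -/
def formPullGen (N : ℕ) : FormGen 1 N → FormGen 2 N := Sum.map (fun _ => 0) (pullGen N)

theorem formPullGen_injective (N : ℕ) : Function.Injective (formPullGen N) := by
  refine Function.Injective.sumMap (fun _ _ _ => Subsingleton.elim _ _)
    (Function.Injective.sumMap (fun _ _ _ => Subsingleton.elim _ _) Function.injective_id)

theorem formPullGen_ne_dz (g : FormGen 1 N) : formPullGen N g ≠ Sum.inl 1 := by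
  rcases g with g | g | g <;> simp [formPullGen, pullGen]

theorem formPullGen_ne_dzbar (g : FormGen 1 N) : formPullGen N g ≠ Sum.inr (Sum.inl 1) := by
  rcases g with g | g | g <;> simp [formPullGen, pullGen]

theorem topCoeff_one (x : Gr (FormGen 1 N)) :
    topCoeff 1 N x = ExteriorAlgebra.map
      (Finsupp.lcomapDomain (fun j : Fin N => (Sum.inr (Sum.inr j) : FormGen 1 N))
        (Sum.inr_injective.comp Sum.inr_injective))
      (contract (Sum.inr (Sum.inl 0)) (contract (Sum.inl 0) x)) := by
  simp [topCoeff, List.finRange_succ]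

theorem topCoeff_two (x : Gr (FormGen 2 N)) :
    topCoeff 2 N x = ExteriorAlgebra.map
      (Finsupp.lcomapDomain (fun j : Fin N => (Sum.inr (Sum.inr j) : FormGen 2 N))
        (Sum.inr_injective.comp Sum.inr_injective))
      (contract (Sum.inr (Sum.inl 0)) (contract (Sum.inl 0)
        (contract (Sum.inr (Sum.inl 1)) (contract (Sum.inl 1) x)))) := by
  simp [topCoeff, List.finRange_succ]

/-- The contractions by `dz_2` and `dz̄_2` act first. They strip the two leading generators and kill
everything pulled back from `ℂ`; the remaining contractions commute with the relabelling. -/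
theorem topCoeff_two_rename (x : Gr (FormGen 1 N)) :
    topCoeff 2 N (gen (Sum.inl 1) * (gen (Sum.inr (Sum.inl 1)) * rename (formPullGen N) x)) =
      topCoeff 1 N x := by
  rw [topCoeff_two, topCoeff_one, contract_gen_mul_self,
    contract_gen_mul_of_ne (by simp), contract_rename_eq_zero formPullGen_ne_dz, mul_zero,
    neg_zero, mul_zero, sub_zero, contract_gen_mul_self,
    contract_rename_eq_zero formPullGen_ne_dzbar, mul_zero, sub_zero]
  have h1 := contract_rename (formPullGen_injective N) (Sum.inl 0) x
  have h2 := contract_rename (formPullGen_injective N) (Sum.inr (Sum.inl 0))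
    (contract (Sum.inl 0) x)
  change contract (Sum.inl 0) (rename (formPullGen N) x) = _ at h1
  change contract (Sum.inr (Sum.inl 0)) (rename (formPullGen N) _) = _ at h2
  rw [h1, h2]
  generalize contract (Sum.inr (Sum.inl 0)) (contract (Sum.inl 0) x) = y
  -- Both sides now project to the parameters `θ_j`, so it suffices to compare the two linear maps
  -- on generators.
  rw [rename, ← AlgHom.comp_apply, ExteriorAlgebra.map_comp_map]
  congr 2
  refine LinearMap.ext fun m => Finsupp.ext fun j => ?_
  exact Finsupp.mapDomain_apply (formPullGen_injective N) m (Sum.inr (Sum.inr j))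

/-- The product has no factor `dz̄_2`. This is what removes the `s^{(2)}` term and the `dz̄_1` part
of `∂̄ρ`. -/
theorem topCoeff_two_no_dzbar (x : Gr (FormGen 1 N)) :
    topCoeff 2 N (rename (formPullGen N) x * gen (Sum.inl 1)) = 0 := by
  rw [topCoeff_two, mul_gen, rename_grParity, contract_gen_mul_self,
    contract_rename_eq_zero formPullGen_ne_dz, mul_zero, sub_zero,
    contract_rename_eq_zero formPullGen_ne_dzbar]
  simp

theorem topCoeff_two_dz_dz (x y : Gr (FormGen 2 N)) :
    topCoeff 2 N (x * (gen (Sum.inl 1) * y) * gen (Sum.inl 1)) = 0 := by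
  rw [mul_assoc, mul_assoc, mul_gen _ y, ← mul_assoc (gen _) (gen _), gen_mul_self]
  simp

/-- The coefficient of `dz_1 ∧ dz̄_1` in `dz_1 ∧ w` up to the parity of `w`. -/
noncomputable def dzCoeff (N : ℕ) : Gr (DolGen 1 N) →ₗ[ℂ] Gr (Fin N) :=
  topCoeff 1 N ∘ₗ LinearMap.mulLeft ℂ (gen (Sum.inl 0)) ∘ₗ (grParity _).toLinearMap ∘ₗ
    (rename Sum.inr).toLinearMap

/-- Moving `dz_1` to the front twists `w` by parity. `dzCoeff` contains a twist of its whole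
argument, so the net effect is a twist on `v` alone. -/
theorem topCoeff_one_mul (w v : Gr (DolGen 1 N)) :
    topCoeff 1 N (rename Sum.inr w * (gen (Sum.inl 0) * rename Sum.inr v)) =
      dzCoeff N (w * grParity _ v) := by
  simp only [dzCoeff, LinearMap.comp_apply, LinearMap.mulLeft_apply, AlgHom.toLinearMap_apply,
    map_mul, rename_grParity, grParity_grParity]
  rw [← mul_assoc, mul_gen, mul_assoc, rename_grParity]

theorem rename_inr_pullGen (w : Gr (DolGen 1 N)) :
    (rename Sum.inr (rename (pullGen N) w) : Gr (FormGen 2 N)) =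
      rename (formPullGen N) (rename Sum.inr w) := by
  rw [rename_rename, rename_rename]
  rfl

theorem gen_inl_zero :
    (gen (Sum.inl 0) : Gr (FormGen 2 N)) = rename (formPullGen N) (gen (Sum.inl 0)) := by
  rw [rename_gen]
  rfl

theorem gen_dzbar_zero :
    (gen (Sum.inr (Sum.inl 0)) : Gr (FormGen 2 N)) =
      rename (formPullGen N) (gen (Sum.inr (Sum.inl 0))) := by
  rw [rename_gen]
  rfl

/-- Bringing `dz_2` to the front twists all factors by parity; bringing `dz̄_2` next to it twists
`w` back and moves past `dz_1`, which leaves the sign. The twist left on `v` cancels the one in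
`topCoeff_one_mul`, so `v` enters untwisted here, unlike in the 2d integral. -/
theorem topCoeff_two_dz_dzbar (w v : Gr (DolGen 1 N)) :
    topCoeff 2 N (rename (formPullGen N) (rename Sum.inr w) * (gen (Sum.inl 0) *
        (gen (Sum.inr (Sum.inl 1)) * rename (formPullGen N) (rename Sum.inr v))) *
          gen (Sum.inl 1)) = -dzCoeff N (w * v) := by
  rw [mul_gen]
  simp only [map_mul, grParity_gen, rename_grParity]
  rw [gen_inl_zero]
  simp only [neg_mul, mul_neg, neg_neg]
  rw [← mul_assoc (rename _ _), ← mul_assoc _ (gen (Sum.inr (Sum.inl 1))),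
    ← map_mul (rename (formPullGen N)), mul_gen _ (rename (formPullGen N) _), mul_assoc,
    rename_grParity, ← map_mul, topCoeff_two_rename]
  rw [map_mul (grParity _), grParity_gen, mul_neg, neg_mul, map_neg, mul_assoc,
    rename_grParity, grParity_grParity, topCoeff_one_mul, grParity_grParity]

end TopCoefficient

/-! ### Evaluation of the cocycles on superfields. -/

section Pairing

variable {n N : ℕ} {𝔤 : Type*} [LieRing 𝔤] [LieAlgebra ℂ 𝔤]

theorem dol_induction {P : Dol n N 𝔤 → Prop} (add : ∀ x y, P x → P y → P (x + y))
    (tmul : ∀ f w X, P (f ⊗ₜ (w ⊗ₜ X))) (x : Dol n N 𝔤) : P x := by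
  induction x using TensorProduct.induction_on with
  | zero => simpa using tmul 0 0 0
  | add x y hx hy => exact add x y hx hy
  | tmul f y =>
    induction y using TensorProduct.induction_on with
    | zero => simpa using tmul f 0 0
    | add x y hx hy => simpa only [TensorProduct.tmul_add] using add _ _ hx hy
    | tmul w X => exact tmul f w X

/-- The pairing `κ(fωX ∧ gηY) = fg (ω ∧ η) κ(X, Y)` of `(0,•)`-forms. -/
noncomputable def dolPair (κ : LinearMap.BilinForm ℂ 𝔤) :
    Dol n N 𝔤 →ₗ[ℂ] Dol n N 𝔤 →ₗ[ℂ] Dol n N ℂ :=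
  TensorProduct.map₂ (mulTest n) (TensorProduct.map₂ (LinearMap.mul ℂ (Gr (DolGen n N))) κ)

theorem mulTest_comm (f g : TestFun n) : mulTest n f g = mulTest n g f :=
  TestFun.ext fun x => mul_comm (f.1 x) (g.1 x)

/-- Oddness does not pass to the pure tensors of a decomposition. Applying `1 - P`, with `P` the
parity operator, projects onto twice the odd part and makes the statement bilinear in arbitrary `α`,
`β`, hence open to induction on tensors. -/
theorem dolPair_sub_dolParity {κ : LinearMap.BilinForm ℂ 𝔤} (hκ : ∀ X Y, κ X Y = κ Y X)
    (α β : Dol n N 𝔤) :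
    dolPair κ (α - dolParity n N 𝔤 α) (β - dolParity n N 𝔤 β) =
      -dolPair κ (β - dolParity n N 𝔤 β) (α - dolParity n N 𝔤 α) := by
  induction α using dol_induction with
  | add x y hx hy =>
    rw [map_add, add_sub_add_comm, map_add, LinearMap.add_apply, hx, hy, map_add, neg_add]
  | tmul f w X =>
  induction β using dol_induction with
  | add x y hx hy =>
    rw [map_add, add_sub_add_comm, map_add, hx, hy, map_add, LinearMap.add_apply, neg_add]
  | tmul g v Y =>
    have hodd : ∀ u : Gr (DolGen n N), grParity _ (u - grParity _ u) = -(u - grParity _ u) :=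
      fun u => by rw [map_sub, grParity_grParity, neg_sub]
    have hP : ∀ (f : TestFun n) (u : Gr (DolGen n N)) (X : 𝔤),
        f ⊗ₜ[ℂ] (u ⊗ₜ[ℂ] X) - dolParity n N 𝔤 (f ⊗ₜ (u ⊗ₜ X)) =
          f ⊗ₜ ((u - grParity _ u) ⊗ₜ X) := fun f u X => by
      simp [dolParity, TensorProduct.tmul_sub, TensorProduct.sub_tmul]
    rw [hP, hP]
    simp only [dolPair, TensorProduct.map₂_apply_tmul, TensorProduct.map_tmul,
      LinearMap.mul_apply']
    rw [mul_eq_of_odd (hodd v), hodd, mulTest_comm, hκ, mul_neg, TensorProduct.neg_tmul,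
      TensorProduct.tmul_neg]

/-- `κ(α ∧ α) = 0` for odd `α`. -/
theorem dolPair_self {κ : LinearMap.BilinForm ℂ 𝔤} (hκ : ∀ X Y, κ X Y = κ Y X)
    {α : Dol n N 𝔤} (hα : dolParity n N 𝔤 α = -α) : dolPair κ α α = 0 := by
  have h := dolPair_sub_dolParity hκ α α
  rw [hα, sub_neg_eq_add, ← two_smul ℂ α] at h
  simp only [map_smul, LinearMap.smul_apply, smul_smul] at h
  -- For odd `α` one has `α - Pα = 2α`, so the antisymmetry reads `4 κ(α ∧ α) = -4 κ(α ∧ α)`.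
  have h2 : ((2 * 2 + 2 * 2 : ℂ)) • dolPair κ α α = 0 := by
    rw [add_smul]
    exact eq_neg_iff_add_eq_zero.1 h
  exact (smul_eq_zero.1 h2).resolve_left (by norm_num)

theorem integral_wedgePair_del_one (κ : LinearMap.BilinForm ℂ 𝔤) (f g : TestFun 1)
    (w v : Gr (DolGen 1 N)) (X Y : 𝔤) :
    integral 1 N (wedgePair κ (toForm (f ⊗ₜ (w ⊗ₜ X)))
      (del (toForm (g ⊗ₜ (v ⊗ₜ Y))))) =
      (-2 * Complex.I * lebesgue 1 (mulTest 1 f (partialTest 0 g)) * κ X Y) •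
        dzCoeff N (w * grParity _ v) := by
  rw [← topCoeff_one_mul]
  simp [integral, wedgePair, toForm, del, TensorProduct.map₂_apply_tmul, smul_smul,
    mul_comm]

/-- The `dz_2 ∂/∂z_2` summand of `∂` dies against the final `dz_2`; the constant `-4` is `(-2i)²`
from the orientation. -/
theorem integral_wedgePull_del (κ : LinearMap.BilinForm ℂ 𝔤) (m m' : VertFun)
    (u : Gr (DolGen 2 N)) (f g : TestFun 1) (w v : Gr (DolGen 1 N)) (X Y : 𝔤) :
    integral 2 N (wedgeDz 1 (wedgePair κ (toForm (wedgePull m 1 (f ⊗ₜ (w ⊗ₜ X))))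
      (del (toForm (wedgePull m' u (g ⊗ₜ (v ⊗ₜ Y))))))) =
      (-4 * lebesgue 2 (mulTest 2 (mulPull m f) (partialTest 0 (mulPull m' g))) * κ X Y) •
        topCoeff 2 N (rename (formPullGen N) (rename Sum.inr w) * (gen (Sum.inl 0) *
          (rename Sum.inr u * rename (formPullGen N) (rename Sum.inr v))) *
            gen (Sum.inl 1)) := by
  have h4 : (-2 * Complex.I) ^ 2 = -4 := by
    rw [mul_pow, Complex.I_sq]
    norm_num
  have h := topCoeff_two_dz_dz (rename (formPullGen N) (rename Sum.inr w))
    (rename Sum.inr u * rename (formPullGen N) (rename Sum.inr v))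
  simp only [integral, h4, wedgePair, wedgeDz, wedgePull, toForm, del, Fin.sum_univ_two,
    LinearMap.add_apply, map_add, TensorProduct.map_tmul, TensorProduct.map₂_apply_tmul,
    LinearMap.comp_apply, LinearMap.mulLeft_apply, LinearMap.mulRight_apply, one_mul, map_mul,
    AlgHom.toLinearMap_apply, LinearMap.id_apply, LinearMap.mul_apply', rename_inr_pullGen, h,
    LinearEquiv.coe_coe, TensorProduct.lid_tmul, TensorProduct.rid_tmul, smul_zero, add_zero,
    LinearMap.smul_apply, smul_smul, smul_eq_mul]

theorem integral_wedgePull_one_del (κ : LinearMap.BilinForm ℂ 𝔤) (m m' : VertFun)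
    (α β : Dol 1 N 𝔤) :
    integral 2 N (wedgeDz 1 (wedgePair κ (toForm (wedgePull m 1 α))
      (del (toForm (wedgePull m' 1 β))))) = 0 := by
  induction α using dol_induction with
  | add x y hx hy => simp only [map_add, LinearMap.add_apply, hx, hy, add_zero]
  | tmul f w X =>
  induction β using dol_induction with
  | add x y hx hy => simp only [map_add, hx, hy, add_zero]
  | tmul g v Y =>
    rw [integral_wedgePull_del, map_one, one_mul, gen_inl_zero, ← map_mul, ← map_mul,
      topCoeff_two_no_dzbar, smul_zero]

variable {ρ : Cn 2 → ℂ}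

/-- The functional on `κ(α ∧ β)` that arises when `∂` falls on `∂̄ρ/z_2`. -/
noncomputable def IsBump.remainder (h : IsBump ρ) (N : ℕ) : Dol 1 N ℂ →ₗ[ℂ] Gr (Fin N) :=
  (TensorProduct.lid ℂ (Gr (Fin N))).toLinearMap ∘ₗ
    TensorProduct.map (lebesgue 2 ∘ₗ mulPull (h.fn.mul ((h.dbarDiv 1).partialZ 0)))
      ((TensorProduct.rid ℂ (Gr (Fin N))).toLinearMap ∘ₗ
        TensorProduct.map (dzCoeff N) LinearMap.id)

/-- Bilinear in arbitrary `α`, `β`, so that it can be checked on pure tensors; oddness is imposed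
only afterwards. The parity operator on `β` records the different twists of `v` in two and four
dimensions. -/
theorem IsBump.integral_wedgeDbarRho (h : IsBump ρ) (κ : LinearMap.BilinForm ℂ 𝔤)
    (α β : Dol 1 N 𝔤) :
    integral 2 N (wedgeDz 1 (wedgePair κ (toForm (h.mulRho α))
      (del (toForm (h.wedgeDbarRho β))))) =
      (-(Real.pi * Complex.I) : ℂ) • integral 1 N (wedgePair κ (toForm α)
        (del (toForm (dolParity 1 N 𝔤 β)))) + (4 : ℂ) • h.remainder N (dolPair κ α β) := by
  induction α using dol_induction with
  | add x y hx hy =>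
    simp only [map_add, LinearMap.add_apply, hx, hy, smul_add]
    abel
  | tmul f w X =>
  induction β using dol_induction with
  | add x y hx hy =>
    simp only [map_add, hx, hy, smul_add]
    abel
  | tmul g v Y =>
    have hP : dolParity 1 N 𝔤 (g ⊗ₜ (v ⊗ₜ Y)) = g ⊗ₜ (grParity _ v ⊗ₜ Y) := by
      simp [dolParity]
    have hR : h.remainder N (dolPair κ (f ⊗ₜ (w ⊗ₜ X)) (g ⊗ₜ (v ⊗ₜ Y))) =
        (lebesgue 2 (mulPull (h.fn.mul ((h.dbarDiv 1).partialZ 0)) (mulTest 1 f g)) * κ X Y) •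
          dzCoeff N (w * v) := by
      simp [remainder, dolPair, TensorProduct.map₂_apply_tmul, smul_smul, mul_comm]
    rw [hP, hR, integral_wedgePair_del_one, grParity_grParity, mulRho, wedgeDbarRho,
      Fin.sum_univ_two, LinearMap.add_apply]
    simp only [map_add]
    rw [integral_wedgePull_del, integral_wedgePull_del, rename_gen, rename_gen,
      topCoeff_two_dz_dzbar, gen_dzbar_zero, gen_inl_zero, ← map_mul, ← map_mul, ← map_mul,
      topCoeff_two_no_dzbar, smul_zero, zero_add, mulTest_mulPull_partialTest, map_add,
      lebesgue_mulPull _ h.integral_fibre, smul_neg, ← neg_smul, smul_smul, smul_smul,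
      ← add_smul]
    congr 1
    -- The coefficient is `(-4)(-π/2)(-1) = -2π`, from orientation, fibre integral and Grassmann
    -- sign; it equals `(-πi)(-2i)`, where `-2i` is the orientation factor on `ℂ`.
    linear_combination
      (-2 * Real.pi * lebesgue 1 (mulTest 1 f (partialTest 0 g)) * κ X Y) * Complex.I_sq

theorem IsBump.phi4d_s (h : IsBump ρ) (κ : InvSym 𝔤) (α : OddDol 1 N 𝔤) :
    phi4d κ N (h.s α) = -(1 / 2 : ℂ) • phi2d κ N α := by
  have h1 := h.integral_wedgeDbarRho κ.1 α.1 α.1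
  rw [dolParity_odd, dolPair_self κ.2.1 (dolParity_odd α), map_zero, smul_zero, add_zero] at h1
  have h2 := integral_wedgePull_one_del κ.1 h.fn h.corr α.1 (dolBracket α.1 α.1)
  have e1 : (h.s α).1.1 = h.mulRho α.1 := by simp [s, s1, s2]
  have e2 : (h.s α).2.1 = -h.wedgeDbarRho α.1 - (1 / 2 : ℂ) • h.corrBracket α.1 α.1 := rfl
  rw [phi4d, phiN2, phi2d, e1, e2]
  have h2' : integral 2 N (wedgeDz 1 (wedgePair κ.1 (toForm (h.mulRho α.1))
      (del (toForm (h.corrBracket α.1 α.1))))) = 0 := h2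
  simp only [map_sub, map_neg, map_smul, h1, h2', smul_zero, sub_zero, smul_neg, neg_neg,
    smul_smul, neg_smul]
  -- The parity sign on `α` and the sign in `s^{(1)}` leave `-πi`, and `(2πi)⁻² (-πi) = -½ (2πi)⁻¹`.
  rw [← neg_smul]
  congr 1
  have := Complex.I_ne_zero
  have : (Real.pi : ℂ) ≠ 0 := Complex.ofReal_ne_zero.2 Real.pi_ne_zero
  field_simp

theorem phi2d_smul (c : ℂ) (κ : InvSym 𝔤) : phi2d (c • κ) = c • phi2d κ := by
  funext N α
  have hw : ∀ a b : Form 1 N 𝔤, wedgePair (c • κ.1) a b = c • wedgePair κ.1 a b := by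
    intro a b
    induction a using TensorProduct.induction_on with
    | zero => simp
    | add x y hx hy => simp only [map_add, LinearMap.add_apply, hx, hy, smul_add]
    | tmul f y =>
    induction y using TensorProduct.induction_on with
    | zero => simp
    | add x y hx hy =>
      simp only [TensorProduct.tmul_add, map_add, LinearMap.add_apply, hx, hy, smul_add]
    | tmul η X =>
    induction b using TensorProduct.induction_on with
    | zero => simp
    | add x y hx hy => simp only [map_add, hx, hy, smul_add]
    | tmul g z =>
    induction z using TensorProduct.induction_on with
    | zero => simp
    | add x y hx hy => simp only [TensorProduct.tmul_add, map_add, hx, hy, smul_add]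
    | tmul ζ Y =>
      simp only [wedgePair, TensorProduct.map₂_apply_tmul, TensorProduct.map_tmul,
        LinearMap.smul_apply, TensorProduct.tmul_smul]
  simp only [phi2d, Pi.smul_apply, Submodule.coe_smul]
  rw [hw, map_smul, smul_comm]

end Pairing

end Currents

theorem mainTheorem6 {𝔤 : Type*} [LieRing 𝔤] [LieAlgebra ℂ 𝔤] (κ : Currents.InvSym 𝔤)
    (ρ : Currents.Cn 2 → ℂ) (hρ : Currents.IsBump ρ) :
    hρ.pullback (Currents.phi4d κ) = -(1 / 2 : ℂ) • Currents.phi2d κ ∧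
      -(1 / 2 : ℂ) • Currents.phi2d κ = Currents.phi2d (-(1 / 2 : ℂ) • κ) :=
  ⟨funext fun _ => funext fun α => hρ.phi4d_s κ α, (Currents.phi2d_smul _ κ).symm⟩
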